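/- Let $(\mathcal C,\mathbb E,\mathfrak s)$ be an extriangulated category (in the sense of Nakaoka and Palu) satisfying Condition (WIC): if $gf$ is an inflation then so is $f$, and if $gf$ is a deflation then so is $g$. Let $\xi$ be a proper class of $\mathbb E$-triangles, that is, a class of $\mathbb E$-triangles closed under isomorphisms, finite coproducts, base change and cobase change, containing all split $\mathbb E$-triangles, and saturated: if $A_1\to B_1\to C\overset{\delta_1}{\dashrightarrow}$ is an $\mathbb E$-triangle, and $A_2\to B_2\xrightarrow{y_2}C\dashrightarrow$ and $A_1\to M\to B_2\overset{y_2^*\delta_1}{\dashrightarrow}$ are in $\xi$, then so is the first one. Assume that $\mathcal C$ has enough $\xi$-projectives and enough $\xi$-injectives. Let $\mathcal W$ be a class of objects of $\mathcal C$ that is closed under finite direct sums and under hocokernels of $\xi$-inflations (if $A\to B\to C\dashrightarrow$ is in $\xi$ and $A,B\in\mathcal W$, then $C\in\mathcal W$). An $\mathbb E$-triangle $A\to B\to C\dashrightarrow$ in $\xi$ is called $\mathcal C(-,\mathcal W)$-exact if $0\to\mathcal C(C,V)\to\mathcal C(B,V)\to\mathcal C(A,V)\to0$ is exact for all $V\in\mathcal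 W$, and $\mathcal C(\mathcal W,-)$-exact if $0\to\mathcal C(V,A)\to\mathcal C(V,B)\to\mathcal C(V,C)\to0$ is exact for all $V\in\mathcal W$. A sequence $0\to Z\to W^0\to W^1\to\cdots$ is called a $\xi$-exact complex (respectively a $\mathcal C(-,\mathcal W)$-exact, a $\mathcal C(\mathcal W,-)$-exact complex) if there are $\mathbb E$-triangles $K^i\to W^i\to K^{i+1}\dashrightarrow$ ($i\ge0$) in $\xi$ (respectively $\mathcal C(-,\mathcal W)$-exact, $\mathcal C(\mathcal W,-)$-exact ones in $\xi$) with $K^0=Z$, such that $Z\to W^0$ is the first morphism of the triangle with $i=0$ and $W^i\to W^{i+1}$ is the composite $W^i\to K^{i+1}\to W^{i+1}$. It is a coproper $\mathcal W(\xi)$-coresolution of $Z$ if it is $\mathcal C(-,\mathcal W)$-exact and all $W^i$ lie in $\mathcal W$. Let $$Y_1\to Y_0\to Y\dashrightarrow\qquad(1)$$ be an $\mathbb E$-triangle in $\xi$, and let $$0\to Y_0\to W_0^0\to W_0^1\to\cdots\to W_0^i\to\cdots\qquad(2)$$ $$0\to Y_1\to W_1^0\to W_1^1\to\cdots\to W_1^i\to\cdots\qquad(3)$$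 be coproper $\mathcal W(\xi)$-coresolutions of $Y_0$ and $Y_1$, respectively. Then there are an object $W$ and a sequence $$0\to Y\to W\to W_0^1\oplus W_1^2\to\cdots\to W_0^i\oplus W_1^{i+1}\to\cdots\qquad(4)$$ such that the following hold. (1) The sequence (4) is a coproper $\mathcal W(\xi)$-coresolution of $Y$ (in particular $W\in\mathcal W$), and there is an $\mathbb E$-triangle $W_1^0\to W_0^0\oplus W_1^1\to W\dashrightarrow$ in $\xi$. (2) If the complexes (2), (3) and the $\mathbb E$-triangle (1) are $\mathcal C(\mathcal W,-)$-exact, then (4) is $\mathcal C(\mathcal W,-)$-exact as well. -/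

import Mathlib

open CategoryTheory CategoryTheory.Limits Opposite

universe w v u

namespace Extri

/-! ### Bifunctors of extensions -/

section Bifunctor

variable {𝒞 : Type u} [Category.{v} 𝒞]

/-- `Extn E C A` is the abelian group `𝔼(C, A)` of `𝔼`-extensions of `C` by `A`. -/
abbrev Extn (E : 𝒞ᵒᵖ ⥤ 𝒞 ⥤ AddCommGrpCat.{w}) (C A : 𝒞) : Type w :=
  ((E.obj (op C)).obj A : Type w)

/-- `push E a δ` is `a_* δ = 𝔼(C, a)(δ)`. -/
def push (E : 𝒞ᵒᵖ ⥤ 𝒞 ⥤ AddCommGrpCat.{w}) {C A A' : 𝒞} (a : A ⟶ A') :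
    Extn E C A →+ Extn E C A' :=
  ((E.obj (op C)).map a).hom

/-- `pull E c δ` is `c^* δ = 𝔼(c, A)(δ)`. -/
def pull (E : 𝒞ᵒᵖ ⥤ 𝒞 ⥤ AddCommGrpCat.{w}) {C C' A : 𝒞} (c : C' ⟶ C) :
    Extn E C A →+ Extn E C' A :=
  ((E.map c.op).app A).hom

/-- The extension `δ ⊕ δ'` in `𝔼(C ⊕ C', A ⊕ A')`, whose components in
`𝔼(C, A)`, `𝔼(C, A')`, `𝔼(C', A)`, `𝔼(C', A')` are `δ`, `0`, `0`, `δ'`. -/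
noncomputable def extSum [Preadditive 𝒞] [HasBinaryBiproducts 𝒞]
    (E : 𝒞ᵒᵖ ⥤ 𝒞 ⥤ AddCommGrpCat.{w}) {C C' A A' : 𝒞}
    (δ : Extn E C A) (δ' : Extn E C' A') : Extn E (C ⊞ C') (A ⊞ A') :=
  pull E biprod.fst (push E biprod.inl δ) + pull E biprod.snd (push E biprod.inr δ')

end Bifunctor

/-! ### Equivalence classes of sequences -/

/-- A sequence `A ⟶ B ⟶ C` with prescribed ends. -/
structure Seq {𝒞 : Type u} [Category.{v} 𝒞] (A C : 𝒞) where
  mid : 𝒞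
  x : A ⟶ mid
  y : mid ⟶ C

/-- Two sequences with the same ends are equivalent if there is an isomorphism of the middle terms
commuting with the morphisms. -/
instance Seq.setoid {𝒞 : Type u} [Category.{v} 𝒞] (A C : 𝒞) : Setoid (Seq A C) where
  r S T := ∃ b : S.mid ≅ T.mid, S.x ≫ b.hom = T.x ∧ b.hom ≫ T.y = S.y
  iseqv :=
    { refl := fun S => ⟨Iso.refl _, by simp, by simp⟩
      symm := by
        rintro S T ⟨b, h1, h2⟩
        exact ⟨b.symm, by simp [← h1], by simp [← h2]⟩
      trans := by
        rintro S T U ⟨b, h1, h2⟩ ⟨b', h3, h4⟩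
        exact ⟨b ≪≫ b', by simp [← h3, ← h1], by simp [h4, h2]⟩ }

/-! ### Extriangulated structures -/

/-- A correspondence `𝔰` sending each extension `δ` in `𝔼(C, A)` to an equivalence class of
sequences `A ⟶ B ⟶ C`. -/
abbrev Correspondence {𝒞 : Type u} [Category.{v} 𝒞]
    (E : 𝒞ᵒᵖ ⥤ 𝒞 ⥤ AddCommGrpCat.{w}) :=
  ∀ ⦃A C : 𝒞⦄, Extn E C A → Quotient (Seq.setoid A C)

/-- `A ⟶ B ⟶ C` is an `𝔼`-triangle realizing `δ`, i.e. `𝔰(δ) = [A ⟶ B ⟶ C]`. -/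
def IsETriangle {𝒞 : Type u} [Category.{v} 𝒞] {E : 𝒞ᵒᵖ ⥤ 𝒞 ⥤ AddCommGrpCat.{w}}
    (s : Correspondence E) {A B C : 𝒞} (x : A ⟶ B) (y : B ⟶ C) (δ : Extn E C A) : Prop :=
  s δ = Quotient.mk (Seq.setoid A C) ⟨B, x, y⟩

/-- An extriangulated structure `(𝔼, 𝔰)` (in the sense of Nakaoka and Palu) on an additive
category. -/
structure ExtriangulatedStructure (𝒞 : Type u) [Category.{v} 𝒞] [Preadditive 𝒞]
    [HasZeroObject 𝒞] [HasBinaryBiproducts 𝒞] where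
  /-- the bifunctor `𝔼`, contravariant in the first and covariant in the second argument -/
  E : 𝒞ᵒᵖ ⥤ 𝒞 ⥤ AddCommGrpCat.{w}
  additive_fst : E.Additive
  additive_snd : ∀ C : 𝒞ᵒᵖ, (E.obj C).Additive
  /-- the realization `𝔰` -/
  s : Correspondence E
  /-- every morphism of extensions is realized by a morphism of sequences -/
  realize : ∀ {A B C A' B' C' : 𝒞} {x : A ⟶ B} {y : B ⟶ C} {δ : Extn E C A}
    {x' : A' ⟶ B'} {y' : B' ⟶ C'} {δ' : Extn E C' A'},
    IsETriangle s x y δ → IsETriangle s x' y' δ' →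
    ∀ (a : A ⟶ A') (c : C ⟶ C'), push E a δ = pull E c δ' →
      ∃ b : B ⟶ B', x ≫ b = a ≫ x' ∧ y ≫ c = b ≫ y'
  /-- the realization is additive: zero extensions -/
  realize_zero : ∀ A C : 𝒞,
    IsETriangle s (biprod.inl : A ⟶ A ⊞ C) (biprod.snd : A ⊞ C ⟶ C) (0 : Extn E C A)
  /-- the realization is additive: direct sums of extensions -/
  realize_sum : ∀ {A B C A' B' C' : 𝒞} {x : A ⟶ B} {y : B ⟶ C} {δ : Extn E C A}
    {x' : A' ⟶ B'} {y' : B' ⟶ C'} {δ' : Extn E C' A'},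
    IsETriangle s x y δ → IsETriangle s x' y' δ' →
      IsETriangle s (biprod.map x x') (biprod.map y y') (extSum E δ δ')
  et3 : ∀ {A B C A' B' C' : 𝒞} {x : A ⟶ B} {y : B ⟶ C} {δ : Extn E C A}
    {x' : A' ⟶ B'} {y' : B' ⟶ C'} {δ' : Extn E C' A'},
    IsETriangle s x y δ → IsETriangle s x' y' δ' →
    ∀ (a : A ⟶ A') (b : B ⟶ B'), x ≫ b = a ≫ x' →
      ∃ c : C ⟶ C', y ≫ c = b ≫ y' ∧ push E a δ = pull E c δ'
  et3_op : ∀ {A B C A' B' C' : 𝒞} {x : A ⟶ B} {y : B ⟶ C} {δ : Extn E C A}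
    {x' : A' ⟶ B'} {y' : B' ⟶ C'} {δ' : Extn E C' A'},
    IsETriangle s x y δ → IsETriangle s x' y' δ' →
    ∀ (b : B ⟶ B') (c : C ⟶ C'), y ≫ c = b ≫ y' →
      ∃ a : A ⟶ A', x ≫ b = a ≫ x' ∧ push E a δ = pull E c δ'
  et4 : ∀ {A B C D F : 𝒞} {f : A ⟶ B} {f' : B ⟶ D} {δ : Extn E D A}
    {g : B ⟶ C} {g' : C ⟶ F} {δ' : Extn E F B},
    IsETriangle s f f' δ → IsETriangle s g g' δ' →
      ∃ (G : 𝒞) (h' : C ⟶ G) (d : D ⟶ G) (e : G ⟶ F) (δ'' : Extn E G A),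
        g ≫ h' = f' ≫ d ∧ h' ≫ e = g' ∧
        IsETriangle s (f ≫ g) h' δ'' ∧
        IsETriangle s d e (push E f' δ') ∧
        pull E d δ'' = δ ∧
        push E f δ'' = pull E e δ'
  et4_op : ∀ {A B C D F : 𝒞} {f' : D ⟶ A} {f : A ⟶ B} {δ : Extn E B D}
    {g' : F ⟶ B} {g : B ⟶ C} {δ' : Extn E C F},
    IsETriangle s f' f δ → IsETriangle s g' g δ' →
      ∃ (G : 𝒞) (d : D ⟶ G) (e : G ⟶ F) (h' : G ⟶ A) (δ'' : Extn E C G),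
        d ≫ h' = f' ∧ h' ≫ f = e ≫ g' ∧
        IsETriangle s h' (f ≫ g) δ'' ∧
        IsETriangle s d e (pull E g' δ) ∧
        push E e δ'' = δ' ∧
        push E d δ = pull E g δ''

section Classes

variable {𝒞 : Type u} [Category.{v} 𝒞] [Preadditive 𝒞] [HasZeroObject 𝒞] [HasBinaryBiproducts 𝒞]
  (X : ExtriangulatedStructure.{w} 𝒞)

/-- `A ⟶ B ⟶ C ⇢` (with extension `δ`) is an `𝔼`-triangle. -/
def ExtriangulatedStructure.Triangle {A B C : 𝒞} (x : A ⟶ B) (y : B ⟶ C)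
    (δ : Extn X.E C A) : Prop :=
  IsETriangle X.s x y δ

/-- `x` is an inflation. -/
def ExtriangulatedStructure.Inflation {A B : 𝒞} (x : A ⟶ B) : Prop :=
  ∃ (C : 𝒞) (y : B ⟶ C) (δ : Extn X.E C A), X.Triangle x y δ

/-- `y` is a deflation. -/
def ExtriangulatedStructure.Deflation {B C : 𝒞} (y : B ⟶ C) : Prop :=
  ∃ (A : 𝒞) (x : A ⟶ B) (δ : Extn X.E C A), X.Triangle x y δ

/-- Condition (WIC). -/
structure ExtriangulatedStructure.WIC : Prop where
  inflation : ∀ {A B C : 𝒞} (f : A ⟶ B) (g : B ⟶ C), X.Inflation (f ≫ g) → X.Inflation f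
  deflation : ∀ {A B C : 𝒞} (f : A ⟶ B) (g : B ⟶ C), X.Deflation (f ≫ g) → X.Deflation g

/-- A predicate on data `(A ⟶ B ⟶ C, δ)`. For a class of `𝔼`-triangles it has to imply
`X.Triangle`, which is part of `IsProperClass` below. -/
abbrev TriangleClass :=
  ∀ ⦃A B C : 𝒞⦄, (A ⟶ B) → (B ⟶ C) → Extn X.E C A → Prop

variable {X}

/-- `ξ` is a proper class of `𝔼`-triangles. -/
structure IsProperClass (ξ : TriangleClass X) : Prop where
  triangle : ∀ {A B C : 𝒞} {x : A ⟶ B} {y : B ⟶ C} {δ : Extn X.E C A},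
    ξ x y δ → X.Triangle x y δ
  /-- closed under isomorphisms of `𝔼`-triangles -/
  iso_closed : ∀ {A B C A' B' C' : 𝒞} {x : A ⟶ B} {y : B ⟶ C} {δ : Extn X.E C A}
    {x' : A' ⟶ B'} {y' : B' ⟶ C'} {δ' : Extn X.E C' A'} (a : A ≅ A') (b : B ≅ B') (c : C ≅ C'),
    ξ x y δ → X.Triangle x' y' δ' → x ≫ b.hom = a.hom ≫ x' → y ≫ c.hom = b.hom ≫ y' →
    push X.E a.hom δ = pull X.E c.hom δ' → ξ x' y' δ'
  /-- closed under finite coproducts (the empty one, `0 ⟶ 0 ⟶ 0`, is split) -/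
  sum_closed : ∀ {A B C A' B' C' : 𝒞} {x : A ⟶ B} {y : B ⟶ C} {δ : Extn X.E C A}
    {x' : A' ⟶ B'} {y' : B' ⟶ C'} {δ' : Extn X.E C' A'},
    ξ x y δ → ξ x' y' δ' → ξ (biprod.map x x') (biprod.map y y') (extSum X.E δ δ')
  /-- contains the split `𝔼`-triangles -/
  split : ∀ {A B C : 𝒞} {x : A ⟶ B} {y : B ⟶ C}, X.Triangle x y 0 → ξ x y 0
  base_change : ∀ {A B C B' C' : 𝒞} {x : A ⟶ B} {y : B ⟶ C} {δ : Extn X.E C A}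
    (c : C' ⟶ C) {x' : A ⟶ B'} {y' : B' ⟶ C'},
    ξ x y δ → X.Triangle x' y' (pull X.E c δ) → ξ x' y' (pull X.E c δ)
  cobase_change : ∀ {A B C A' B' : 𝒞} {x : A ⟶ B} {y : B ⟶ C} {δ : Extn X.E C A}
    (a : A ⟶ A') {x' : A' ⟶ B'} {y' : B' ⟶ C},
    ξ x y δ → X.Triangle x' y' (push X.E a δ) → ξ x' y' (push X.E a δ)
  saturated : ∀ {A₁ B₁ A₂ B₂ C M : 𝒞} {x₁ : A₁ ⟶ B₁} {y₁ : B₁ ⟶ C} {δ₁ : Extn X.E C A₁}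
    {x₂ : A₂ ⟶ B₂} {y₂ : B₂ ⟶ C} {δ₂ : Extn X.E C A₂} {m₁ : A₁ ⟶ M} {e₁ : M ⟶ B₂},
    X.Triangle x₁ y₁ δ₁ → ξ x₂ y₂ δ₂ → ξ m₁ e₁ (pull X.E y₂ δ₁) → ξ x₁ y₁ δ₁

/-- `0 ⟶ 𝒞(V, A) ⟶ 𝒞(V, B) ⟶ 𝒞(V, C) ⟶ 0` is exact. -/
def HomFromExact (V : 𝒞) {A B C : 𝒞} (x : A ⟶ B) (y : B ⟶ C) : Prop :=
  Function.Injective (fun h : V ⟶ A => h ≫ x) ∧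
  Function.Exact (fun h : V ⟶ A => h ≫ x) (fun h : V ⟶ B => h ≫ y) ∧
  Function.Surjective (fun h : V ⟶ B => h ≫ y)

/-- `0 ⟶ 𝒞(C, V) ⟶ 𝒞(B, V) ⟶ 𝒞(A, V) ⟶ 0` is exact. -/
def HomToExact (V : 𝒞) {A B C : 𝒞} (x : A ⟶ B) (y : B ⟶ C) : Prop :=
  Function.Injective (fun h : C ⟶ V => y ≫ h) ∧
  Function.Exact (fun h : C ⟶ V => y ≫ h) (fun h : B ⟶ V => x ≫ h) ∧
  Function.Surjective (fun h : B ⟶ V => x ≫ h)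

def XiProjective (ξ : TriangleClass X) (P : 𝒞) : Prop :=
  ∀ ⦃A B C : 𝒞⦄ (x : A ⟶ B) (y : B ⟶ C) (δ : Extn X.E C A), ξ x y δ → HomFromExact P x y

def XiInjective (ξ : TriangleClass X) (I : 𝒞) : Prop :=
  ∀ ⦃A B C : 𝒞⦄ (x : A ⟶ B) (y : B ⟶ C) (δ : Extn X.E C A), ξ x y δ → HomToExact I x y

def EnoughXiProjectives (ξ : TriangleClass X) : Prop :=
  ∀ A : 𝒞, ∃ (K P : 𝒞) (x : K ⟶ P) (y : P ⟶ A) (δ : Extn X.E A K),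
    XiProjective ξ P ∧ ξ x y δ

def EnoughXiInjectives (ξ : TriangleClass X) : Prop :=
  ∀ A : 𝒞, ∃ (I K : 𝒞) (x : A ⟶ I) (y : I ⟶ K) (δ : Extn X.E K A),
    XiInjective ξ I ∧ ξ x y δ

/-- `𝒲` is closed under hocokernels of `ξ`-inflations. -/
def ClosedUnderHocokernels (ξ : TriangleClass X) (𝒲 : ObjectProperty 𝒞) : Prop :=
  ∀ ⦃A B C : 𝒞⦄ (x : A ⟶ B) (y : B ⟶ C) (δ : Extn X.E C A), ξ x y δ → 𝒲 A → 𝒲 B → 𝒲 C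

/-- `𝒲` is closed under direct sums of two objects. -/
def ClosedUnderDirectSums (𝒲 : ObjectProperty 𝒞) : Prop :=
  ∀ ⦃A B : 𝒞⦄, 𝒲 A → 𝒲 B → 𝒲 (A ⊞ B)

/-- The `𝒞(-, 𝒲)`-exact `𝔼`-triangles in `ξ`. -/
def toExactTriangles (ξ : TriangleClass X) (𝒲 : ObjectProperty 𝒞) : TriangleClass X :=
  fun _ _ _ x y δ => ξ x y δ ∧ ∀ V, 𝒲 V → HomToExact V x y

/-- The `𝒞(𝒲, -)`-exact `𝔼`-triangles in `ξ`. -/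
def fromExactTriangles (ξ : TriangleClass X) (𝒲 : ObjectProperty 𝒞) : TriangleClass X :=
  fun _ _ _ x y δ => ξ x y δ ∧ ∀ V, 𝒲 V → HomFromExact V x y

/-- The sequence `0 ⟶ Y ⟶ W 0 ⟶ W 1 ⟶ ⋯`, with morphisms `ε : Y ⟶ W 0` and
`d i : W i ⟶ W (i + 1)`, is spliced from `𝔼`-triangles
`Y ⟶ W 0 ⟶ K 0` and `K i ⟶ W (i + 1) ⟶ K (i + 1)` that all belong to `η`.
For `η = ξ` this says that it is a `ξ`-exact complex; for `η = toExactTriangles ξ 𝒲`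
(resp. `η = fromExactTriangles ξ 𝒲`) that it is `𝒞(-, 𝒲)`-exact (resp. `𝒞(𝒲, -)`-exact). -/
def SplicedFrom (η : TriangleClass X) {Y : 𝒞} {W : ℕ → 𝒞} (ε : Y ⟶ W 0)
    (d : ∀ i, W i ⟶ W (i + 1)) : Prop :=
  ∃ (K : ℕ → 𝒞) (f : ∀ i, W i ⟶ K i) (g : ∀ i, K i ⟶ W (i + 1))
    (δ₀ : Extn X.E (K 0) Y) (δ : ∀ i, Extn X.E (K (i + 1)) (K i)),
    η ε (f 0) δ₀ ∧ (∀ i, η (g i) (f (i + 1)) (δ i)) ∧ ∀ i, d i = f i ≫ g i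

/-- `0 ⟶ Y ⟶ W 0 ⟶ W 1 ⟶ ⋯` is a coproper `𝒲(ξ)`-coresolution of `Y`. -/
def IsCoproperCoresolution (ξ : TriangleClass X) (𝒲 : ObjectProperty 𝒞) {Y : 𝒞} {W : ℕ → 𝒞}
    (ε : Y ⟶ W 0) (d : ∀ i, W i ⟶ W (i + 1)) : Prop :=
  (∀ i, 𝒲 (W i)) ∧ SplicedFrom (toExactTriangles ξ 𝒲) ε d

end Classes

/-- The terms `W, W₀ 1 ⊕ W₁ 2, W₀ 2 ⊕ W₁ 3, …`. -/
noncomputable def coneTerms {𝒞 : Type u} [Category.{v} 𝒞] [Preadditive 𝒞]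
    [HasBinaryBiproducts 𝒞] (W : 𝒞) (W₀ W₁ : ℕ → 𝒞) : ℕ → 𝒞
  | 0 => W
  | i + 1 => W₀ (i + 1) ⊞ W₁ (i + 2)

end Extri

/-!
Let `L` be the pushout of `Y₁ ⟶ Y₀` and `Y₁ ⟶ W₁ 0`. It sits in two `𝔼`-triangles
(`Triangle.exists_common_pushout`): the cobase change `W₁ 0 ⟶ L ⟶ Y` of the given triangle, and the
cobase change `Y₀ ⟶ L ⟶ K` of `Y₁ ⟶ W₁ 0 ⟶ K`. The second one is again `𝒞(-, 𝒲)`-exact, and its ends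
have the coresolutions `W₀` and `W₁` shifted by one, so the horseshoe lemma (`exists_horseshoe`)
gives a coresolution of `L` with terms `W₀ i ⊞ W₁ (i + 1)`. Applying (ET4) to
`W₁ 0 ⟶ L ⟶ W₀ 0 ⊞ W₁ 1` replaces `L` by `Y` and the term in degree zero by the cone `W` of the
composite, and leaves the higher degrees unchanged (`exists_coresolution_quotient`).

Two points need care.

* The composite of two inflations of triangles in `ξ` is again one (`IsProperClass.comp`). This rests
  on saturation, applied to the deflation of a pushout square. That a pushout square is itself an
  `𝔼`-triangle (`Triangle.pushout`) comes from (ET4) and the five lemma.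
* The syzygies in a splicing are part of an existential statement, so a `𝒞(𝒲, -)`-exact splicing of a
  complex could differ from a given `𝒞(-, 𝒲)`-exact one. Cones of inflations are unique up to
  isomorphism (`Triangle.exists_cone_iso`), and the deflations of a `𝒞(-, 𝒲)`-exact splicing are epic
  against objects of `𝒲`; therefore the two splicings are isomorphic
  (`IsCoproperCoresolution.exactTriangles`).

The triangles used in the construction form the class `exactTriangles ξ 𝒲 P`, where `P` says that both
coresolutions are `𝒞(𝒲, -)`-exact. It is closed under cobase change and under composition of inflations
for every `P`, and so one construction yields both exactness statements about the result.
-/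

namespace Extri

/-! ### The bifunctor of extensions -/

section Bifunctor

variable {𝒞 : Type u} [Category.{v} 𝒞] (E : 𝒞ᵒᵖ ⥤ 𝒞 ⥤ AddCommGrpCat.{w})

@[simp]
lemma push_id {C A : 𝒞} (δ : Extn E C A) : push E (𝟙 A) δ = δ := by
  simp [push]

@[simp]
lemma pull_id {C A : 𝒞} (δ : Extn E C A) : pull E (𝟙 C) δ = δ := by
  simp [pull]

lemma push_comp {C A A' A'' : 𝒞} (a : A ⟶ A') (a' : A' ⟶ A'') (δ : Extn E C A) :
    push E (a ≫ a') δ = push E a' (push E a δ) := by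
  simp [push]

lemma pull_comp {C C' C'' A : 𝒞} (c' : C'' ⟶ C') (c : C' ⟶ C) (δ : Extn E C A) :
    pull E (c' ≫ c) δ = pull E c' (pull E c δ) := by
  simp [pull]

lemma push_pull {C C' A A' : 𝒞} (a : A ⟶ A') (c : C' ⟶ C) (δ : Extn E C A) :
    push E a (pull E c δ) = pull E c (push E a δ) :=
  (ConcreteCategory.congr_hom ((E.map c.op).naturality a) δ).symm

end Bifunctor

section HomExact

variable {𝒞 : Type u} [Category.{v} 𝒞] [Preadditive 𝒞] {A B C V : 𝒞} {x : A ⟶ B} {y : B ⟶ C}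

lemma HomToExact.eq_zero (h : HomToExact V x y) {k : C ⟶ V} (hk : y ≫ k = 0) : k = 0 :=
  h.1 (by simpa using hk)

lemma HomFromExact.eq_zero (h : HomFromExact V x y) {k : V ⟶ A} (hk : k ≫ x = 0) : k = 0 :=
  h.1 (by simpa using hk)

lemma HomFromExact.of_iso {A' B' C' : 𝒞} {x' : A' ⟶ B'} {y' : B' ⟶ C'}
    (h : HomFromExact V x' y') (a : A ≅ A') (b : B ≅ B') (c : C ≅ C')
    (hab : x ≫ b.hom = a.hom ≫ x') (hbc : y ≫ c.hom = b.hom ≫ y') : HomFromExact V x y := by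
  have h₁ : ∀ k : V ⟶ A, (k ≫ a.hom) ≫ x' = (k ≫ x) ≫ b.hom := by simp [hab]
  have h₂ : ∀ k : V ⟶ B, (k ≫ b.hom) ≫ y' = (k ≫ y) ≫ c.hom := by simp [hbc]
  refine ⟨fun k l hkl => ?_, fun k => ⟨fun hk => ?_, ?_⟩, fun k => ?_⟩
  · rw [← cancel_mono a.hom]
    apply h.1
    simp only [h₁, show k ≫ x = l ≫ x from hkl]
  · obtain ⟨l, hl⟩ := (h.2.1 (k ≫ b.hom)).1 (by simp only [h₂, show k ≫ y = 0 from hk, zero_comp])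
    refine ⟨l ≫ a.inv, ?_⟩
    rw [← cancel_mono b.hom]
    simpa [hab] using hl
  · rintro ⟨l, rfl⟩
    rw [← cancel_mono c.hom, ← h₂, ← h₁, zero_comp]
    exact h.2.1.apply_apply_eq_zero _
  · obtain ⟨l, hl⟩ := h.2.2 (k ≫ c.hom)
    refine ⟨l ≫ b.inv, ?_⟩
    rw [← cancel_mono c.hom]
    simpa [hbc] using hl

end HomExact

section Structure

variable {𝒞 : Type u} [Category.{v} 𝒞] [Preadditive 𝒞] [HasZeroObject 𝒞] [HasBinaryBiproducts 𝒞]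

namespace ExtriangulatedStructure

variable (X : ExtriangulatedStructure.{w} 𝒞)

lemma pull_add {C C' A : 𝒞} (c c' : C' ⟶ C) (δ : Extn X.E C A) :
    pull X.E (c + c') δ = pull X.E c δ + pull X.E c' δ := by
  have := X.additive_fst
  simp [pull, X.E.map_add]

variable {X}

/-! ### Exactness of `𝔼`-triangles -/

variable (X) in
lemma exists_triangle {A C : 𝒞} (δ : Extn X.E C A) :
    ∃ (B : 𝒞) (x : A ⟶ B) (y : B ⟶ C), X.Triangle x y δ := by
  obtain ⟨⟨B, x, y⟩, h⟩ := Quotient.exists_rep (X.s δ)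
  exact ⟨B, x, y, h.symm⟩

lemma Triangle.exists_iso {A B B' C : 𝒞} {x : A ⟶ B} {y : B ⟶ C} {x' : A ⟶ B'} {y' : B' ⟶ C}
    {δ : Extn X.E C A} (h : X.Triangle x y δ) (h' : X.Triangle x' y' δ) :
    ∃ b : B ≅ B', x ≫ b.hom = x' ∧ b.hom ≫ y' = y :=
  Quotient.exact ((h : _ = _).symm.trans h')

lemma Triangle.of_mid_iso {A B B' C : 𝒞} {x : A ⟶ B} {y : B ⟶ C} {x' : A ⟶ B'} {y' : B' ⟶ C}
    {δ : Extn X.E C A} (h : X.Triangle x y δ) (b : B ≅ B') (hx : x ≫ b.hom = x')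
    (hy : b.hom ≫ y' = y) : X.Triangle x' y' δ :=
  (h : _ = _).trans (Quotient.sound ⟨b, hx, hy⟩)

variable (X) in
/-- A short exact sequence of a direct sum decomposition realizes the zero extension. -/
lemma triangle_of_split {A B C : 𝒞} (x : A ⟶ B) (y : B ⟶ C) (r : B ⟶ A) (t : C ⟶ B)
    (hxr : x ≫ r = 𝟙 A) (hty : t ≫ y = 𝟙 C) (hxy : x ≫ y = 0) (htr : t ≫ r = 0)
    (hB : r ≫ x + y ≫ t = 𝟙 B) : X.Triangle x y 0 :=
  Triangle.of_mid_iso (X := X) (X.realize_zero A C)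
    { hom := biprod.desc x t
      inv := biprod.lift r y
      hom_inv_id := by ext <;> simp [hxr, hty, hxy, htr]
      inv_hom_id := by simp [biprod.lift_desc, hB] }
    (by simp) (by ext <;> simp [hxy, hty])

open ZeroObject in
variable (X) in
lemma triangle_id_zero (A : 𝒞) : X.Triangle (𝟙 A) (0 : A ⟶ 0) 0 :=
  X.triangle_of_split _ _ (𝟙 A) 0 (by simp) (by ext) (by simp) (by simp) (by simp)

open ZeroObject in
variable (X) in
lemma triangle_zero_id (C : 𝒞) : X.Triangle (0 : 0 ⟶ C) (𝟙 C) 0 :=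
  X.triangle_of_split _ _ 0 (𝟙 C) (by ext) (by simp) (by simp) (by simp) (by simp)

section

variable {A B C : 𝒞} {x : A ⟶ B} {y : B ⟶ C} {δ : Extn X.E C A}

lemma Triangle.comp_eq_zero (h : X.Triangle x y δ) : x ≫ y = 0 := by
  obtain ⟨c, hc, -⟩ := X.et3 (X.triangle_id_zero A) h (𝟙 A) x (by simp)
  simpa using hc.symm

lemma Triangle.push_eq_zero (h : X.Triangle x y δ) : push X.E x δ = 0 := by
  obtain ⟨c, -, hc⟩ := X.et3 h (X.triangle_id_zero B) x (𝟙 B) (by simp)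
  simpa using hc

lemma Triangle.pull_eq_zero (h : X.Triangle x y δ) : pull X.E y δ = 0 := by
  obtain ⟨c, -, hc⟩ := X.et3_op (X.triangle_zero_id B) h (𝟙 B) y (by simp)
  simpa using hc.symm

lemma Triangle.exists_lift (h : X.Triangle x y δ) {T : 𝒞} (t : T ⟶ B) (ht : t ≫ y = 0) :
    ∃ s : T ⟶ A, s ≫ x = t := by
  obtain ⟨a, ha, -⟩ := X.et3_op (X.triangle_id_zero T) h t 0 (by simp [ht])
  exact ⟨a, by simpa using ha.symm⟩

lemma Triangle.exists_desc (h : X.Triangle x y δ) {T : 𝒞} (t : B ⟶ T) (ht : x ≫ t = 0) :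
    ∃ s : C ⟶ T, y ≫ s = t := by
  obtain ⟨c, hc, -⟩ := X.et3 h (X.triangle_zero_id T) 0 t (by simp [ht])
  exact ⟨c, by simpa using hc⟩

lemma Triangle.exists_lift_of_pull (h : X.Triangle x y δ) {T : 𝒞} (t : T ⟶ C)
    (ht : pull X.E t δ = 0) : ∃ s : T ⟶ B, s ≫ y = t := by
  obtain ⟨b, -, hb⟩ := X.realize (X.realize_zero A T) h (𝟙 A) t (by simp [ht])
  exact ⟨biprod.inr ≫ b, by simp [← hb]⟩

lemma Triangle.exists_desc_of_push (h : X.Triangle x y δ) {T : 𝒞} (t : A ⟶ T)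
    (ht : push X.E t δ = 0) : ∃ s : B ⟶ T, x ≫ s = t := by
  obtain ⟨b, hb, -⟩ := X.realize h (X.realize_zero T C) t (𝟙 C) (by simp [ht])
  exact ⟨b ≫ biprod.fst, by rw [reassoc_of% hb]; simp⟩

variable {A' B' C' : 𝒞} {x' : A' ⟶ B'} {y' : B' ⟶ C'} {δ' : Extn X.E C' A'}

/-- The five lemma for the middle terms. -/
lemma Triangle.isIso_mid (h : X.Triangle x y δ) (h' : X.Triangle x' y' δ') (a : A ≅ A')
    (b : B ⟶ B') (c : C ≅ C') (hab : x ≫ b = a.hom ≫ x') (hbc : y ≫ c.hom = b ≫ y')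
    (hac : push X.E a.hom δ = pull X.E c.hom δ') : IsIso b := by
  have hδ : δ = push X.E a.inv (pull X.E c.hom δ') := by
    rw [← hac, ← push_comp]; simp
  have hδ' : δ' = pull X.E c.inv (push X.E a.hom δ) := by
    rw [hac, ← pull_comp]; simp
  -- a section of `b`, from exactness of `𝒞(B', -)`
  have epi : ∃ t : B' ⟶ B, t ≫ b = 𝟙 B' := by
    obtain ⟨t, ht⟩ := h.exists_lift_of_pull (y' ≫ c.inv) (by
      rw [hδ, ← push_pull, ← pull_comp]; simp [h'.pull_eq_zero])
    obtain ⟨s, hs⟩ := h'.exists_lift (𝟙 B' - t ≫ b) (by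
      simp [Preadditive.sub_comp, ← hbc, reassoc_of% ht])
    refine ⟨t + s ≫ a.inv ≫ x, ?_⟩
    simp [Preadditive.add_comp, hab, hs]
  -- a retraction of `b`, from exactness of `𝒞(-, B)`
  have mono : ∃ t : B' ⟶ B, b ≫ t = 𝟙 B := by
    obtain ⟨t, ht⟩ := h'.exists_desc_of_push (a.inv ≫ x) (by
      rw [hδ', push_pull, ← push_comp]; simp [h.push_eq_zero])
    obtain ⟨s, hs⟩ := h.exists_desc (𝟙 B - b ≫ t) (by
      simp [Preadditive.comp_sub, reassoc_of% hab, ht])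
    refine ⟨t + y' ≫ c.inv ≫ s, ?_⟩
    simp [Preadditive.comp_add, ← reassoc_of% hbc, hs]
  obtain ⟨t, ht⟩ := epi
  obtain ⟨r, hr⟩ := mono
  have : r = t := by rw [← Category.id_comp r, ← ht, Category.assoc, hr, Category.comp_id]
  exact ⟨r, hr, by rw [this, ht]⟩

/-- A sequence isomorphic to an `𝔼`-triangle, compatibly with the extensions, is an
`𝔼`-triangle. -/
lemma Triangle.of_iso (h : X.Triangle x y δ) (a : A ≅ A') (b : B ≅ B') (c : C ≅ C')
    (hab : x ≫ b.hom = a.hom ≫ x') (hbc : y ≫ c.hom = b.hom ≫ y')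
    (hac : push X.E a.hom δ = pull X.E c.hom δ') : X.Triangle x' y' δ' := by
  obtain ⟨B₀, x₀, y₀, h₀⟩ := X.exists_triangle δ'
  obtain ⟨b₀, hb₁, hb₂⟩ := X.realize h h₀ a.hom c.hom hac
  have := h.isIso_mid h₀ a b₀ c hb₁ hb₂ hac
  refine h₀.of_mid_iso ((asIso b₀).symm ≪≫ b) ?_ ?_
  · rw [← cancel_epi a.hom, ← hab, ← reassoc_of% hb₁]; simp
  · simp [← hbc, hb₂]

/-- The uniqueness of the cone of an inflation. The two comparison morphisms between the cones need
not be mutually inverse, but their composites differ from the identities by endomorphisms of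
square zero. -/
lemma Triangle.exists_cone_iso (h : X.Triangle x y δ) (h' : X.Triangle x' y' δ') (a : A ≅ A')
    (b : B ≅ B') (hab : x ≫ b.hom = a.hom ≫ x') : ∃ c : C ≅ C', y ≫ c.hom = b.hom ≫ y' := by
  have key : ∀ {A B C : 𝒞} {x : A ⟶ B} {y : B ⟶ C} {δ : Extn X.E C A}, X.Triangle x y δ →
      ∀ u : C ⟶ C, y ≫ u = y → pull X.E u δ = δ → IsIso u := by
    intro A B C x y δ h u hu hδ
    obtain ⟨q, hq⟩ := h.exists_lift_of_pull (u - 𝟙 C) (by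
      have := X.pull_add (u - 𝟙 C) (𝟙 C) δ
      simpa [hδ] using this)
    have hn : (u - 𝟙 C) ≫ (u - 𝟙 C) = 0 := by
      nth_rw 1 [← hq]
      simp [Preadditive.comp_sub, hu]
    refine ⟨𝟙 C - (u - 𝟙 C), ?_, ?_⟩
    all_goals
      simp only [Preadditive.comp_sub, Preadditive.sub_comp, Category.comp_id,
        Category.id_comp] at hn ⊢
      rw [← sub_eq_zero, ← neg_eq_zero, ← hn]
      abel
  obtain ⟨c, hc, hcδ⟩ := X.et3 h h' a.hom b.hom hab
  obtain ⟨c', hc', hcδ'⟩ := X.et3 h' h a.inv b.inv (by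
    rw [← cancel_epi a.hom, ← reassoc_of% hab]; simp)
  have h₁ : IsIso (c ≫ c') := key h _ (by rw [reassoc_of% hc, hc']; simp) (by
    rw [pull_comp, ← hcδ', ← push_pull, ← hcδ, ← push_comp]; simp)
  have h₂ : IsIso (c' ≫ c) := key h' _ (by rw [reassoc_of% hc', hc]; simp) (by
    rw [pull_comp, ← hcδ, ← push_pull, ← hcδ', ← push_comp]; simp)
  have : IsSplitEpi c := ⟨⟨inv (c' ≫ c) ≫ c', by simp⟩⟩
  have : Mono c := mono_of_mono c c'
  have : IsIso c := isIso_of_mono_of_isSplitEpi c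
  exact ⟨asIso c, hc⟩

end

/-! ### Sums with trivial triangles, pushouts and pullbacks -/

open ZeroObject in
/-- Adding `D ⟶ D ⟶ 0` to the left of an `𝔼`-triangle. -/
lemma Triangle.add_id_left {A B C : 𝒞} {x : A ⟶ B} {y : B ⟶ C} {δ : Extn X.E C A}
    (h : X.Triangle x y δ) (D : 𝒞) :
    X.Triangle (biprod.map (𝟙 D) x) (biprod.snd ≫ y) (push X.E (biprod.inr : A ⟶ D ⊞ A) δ) := by
  refine Triangle.of_iso (X := X) (X.realize_sum (X.triangle_id_zero D) h)
    (Iso.refl _) (Iso.refl _)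
    { hom := biprod.snd, inv := biprod.inr, hom_inv_id := by ext; simp } ?_ ?_ ?_
  · simp
  · simp
  · simp [extSum]

open ZeroObject in
/-- Adding `0 ⟶ D ⟶ D` to the right of an `𝔼`-triangle. -/
lemma Triangle.add_id_right {A B C : 𝒞} {x : A ⟶ B} {y : B ⟶ C} {δ : Extn X.E C A}
    (h : X.Triangle x y δ) (D : 𝒞) :
    X.Triangle (x ≫ biprod.inl) (biprod.map y (𝟙 D)) (pull X.E (biprod.fst : C ⊞ D ⟶ C) δ) := by
  refine Triangle.of_iso (X := X) (X.realize_sum h (X.triangle_zero_id D))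
    { hom := biprod.fst, inv := biprod.inl, hom_inv_id := by ext; simp }
    (Iso.refl _) (Iso.refl _) ?_ ?_ ?_
  · ext <;> simp
  · simp
  · simp [extSum, push_pull, ← push_comp]

/-- If `A' ⟶ B' ⟶ C` is the cobase change of `A ⟶ B ⟶ C` along `a`, then the pushout square is
an `𝔼`-triangle `A ⟶ A' ⊞ B ⟶ B'`. -/
lemma Triangle.pushout {A B C A' B' : 𝒞} {x : A ⟶ B} {y : B ⟶ C} {δ : Extn X.E C A}
    (h : X.Triangle x y δ) (a : A ⟶ A') {x' : A' ⟶ B'} {y' : B' ⟶ C}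
    (h' : X.Triangle x' y' (push X.E a δ)) :
    ∃ b : B ⟶ B', b ≫ y' = y ∧
      X.Triangle (biprod.lift (-a) x) (biprod.desc x' b) (pull X.E y' δ) := by
  -- `A ⟶ A' ⊞ A ⟶ A'` is a split triangle, whose inflation is composed with `A' ⊞ A ⟶ A' ⊞ B`
  have hs : X.Triangle (biprod.lift (-a) (𝟙 A)) (biprod.desc (𝟙 A') a) 0 :=
    X.triangle_of_split _ _ biprod.snd biprod.inl (by simp) (by simp) (by simp) (by simp)
      (by ext <;> simp)
  obtain ⟨G, q, d, e, δ'', h1, h2, h3, h4, -, h6⟩ := X.et4 hs (h.add_id_left A')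
  have h4' : X.Triangle d e (push X.E a δ) := by
    have := h4
    rwa [← push_comp, biprod.inr_desc] at this
  have h3' : X.Triangle (biprod.lift (-a) x) q (pull X.E e δ) := by
    have hδ : δ'' = pull X.E e δ := by
      have := congrArg (push X.E (biprod.snd : A' ⊞ A ⟶ A)) h6
      rw [← push_comp, push_pull, ← push_comp] at this
      simpa using this
    have hx : biprod.lift (-a) (𝟙 A) ≫ biprod.map (𝟙 A') x = biprod.lift (-a) x := by
      ext <;> simp
    rw [← hδ, ← hx]
    exact h3
  obtain ⟨b, hb₁, hb₂⟩ := h4'.exists_iso h'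
  have hd : biprod.inl ≫ q = d := by
    have := congrArg (biprod.inl ≫ ·) h1
    simpa using this
  have he : biprod.inr ≫ q ≫ e = y := by simp [h2]
  refine ⟨biprod.inr ≫ q ≫ b.hom, by simp [hb₂, he], ?_⟩
  refine h3'.of_iso (Iso.refl _) (Iso.refl _) b (by simp) ?_ ?_
  · ext <;> simp [← hb₁, ← hd]
  · simp [← pull_comp, hb₂]

/-- If `A ⟶ L ⟶ D` is the base change of `A ⟶ B ⟶ C` along `c`, then the pullback square is
an `𝔼`-triangle `L ⟶ B ⊞ D ⟶ C`. -/
lemma Triangle.pullback {A B C D L : 𝒞} {x : A ⟶ B} {y : B ⟶ C} {δ : Extn X.E C A}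
    (h : X.Triangle x y δ) (c : D ⟶ C) {u : A ⟶ L} {v : L ⟶ D}
    (h' : X.Triangle u v (pull X.E c δ)) :
    ∃ r : L ⟶ B, u ≫ r = x ∧
      X.Triangle (biprod.lift r v) (biprod.desc y (-c)) (push X.E u δ) := by
  -- `D ⟶ C ⊞ D ⟶ C` is a split triangle, whose deflation is composed with `B ⊞ D ⟶ C ⊞ D`
  have hs : X.Triangle (biprod.lift c (𝟙 D)) (biprod.desc (𝟙 C) (-c)) 0 :=
    X.triangle_of_split _ _ biprod.snd biprod.inl (by simp) (by simp) (by simp) (by simp)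
      (by ext <;> simp)
  obtain ⟨G, d, e, q, δ'', h1, h2, h3, h4, -, h6⟩ := X.et4_op (h.add_id_right D) hs
  have h4' : X.Triangle d e (pull X.E c δ) := by
    have := h4
    rwa [← pull_comp, biprod.lift_fst] at this
  have h3' : X.Triangle q (biprod.desc y (-c)) (push X.E d δ) := by
    have hδ : δ'' = push X.E d δ := by
      have := congrArg (pull X.E (biprod.inl : C ⟶ C ⊞ D)) h6
      rw [← pull_comp, ← push_pull, ← pull_comp] at this
      simpa using this.symm
    have hy : biprod.map y (𝟙 D) ≫ biprod.desc (𝟙 C) (-c) = biprod.desc y (-c) := by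
      ext <;> simp
    rw [← hδ, ← hy]
    exact h3
  obtain ⟨b, hb₁, hb₂⟩ := h'.exists_iso h4'
  have he : q ≫ biprod.snd = e := by
    have := congrArg (· ≫ biprod.snd) h2
    simpa using this
  have hd : d ≫ q ≫ biprod.fst = x := by simp [reassoc_of% h1]
  refine ⟨b.hom ≫ q ≫ biprod.fst, by simp [reassoc_of% hb₁, hd], ?_⟩
  refine h3'.of_iso b.symm (Iso.refl _) (Iso.refl _) ?_ (by simp) ?_
  · rw [← cancel_epi b.hom]
    ext <;> simp [← hb₂, ← he]
  · simp [← push_comp, ← hb₁]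

/-- The pushout of two inflations with a common source: both cobase changes can be realized with
the same middle term, as both of their pushout squares are cones of the same inflation. -/
lemma Triangle.exists_common_pushout {A B C B' C' : 𝒞} {x : A ⟶ B} {y : B ⟶ C} {δ : Extn X.E C A}
    {x' : A ⟶ B'} {y' : B' ⟶ C'} {δ' : Extn X.E C' A} (h : X.Triangle x y δ)
    (h' : X.Triangle x' y' δ') :
    ∃ (L : 𝒞) (u : B' ⟶ L) (v : L ⟶ C) (u' : B ⟶ L) (v' : L ⟶ C'),
      X.Triangle u v (push X.E x' δ) ∧ X.Triangle u' v' (push X.E x δ') := by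
  obtain ⟨L, u, v, hL⟩ := X.exists_triangle (push X.E x' δ)
  obtain ⟨L', u', v', hL'⟩ := X.exists_triangle (push X.E x δ')
  obtain ⟨b, -, hb⟩ := h.pushout x' hL
  obtain ⟨b', -, hb'⟩ := h'.pushout x hL'
  let e : B' ⊞ B ≅ B ⊞ B' :=
    { hom := biprod.lift (-biprod.snd) (-biprod.fst)
      inv := biprod.lift (-biprod.snd) (-biprod.fst) }
  obtain ⟨c, -⟩ := hb'.exists_cone_iso hb (Iso.refl _) e.symm (by ext <;> simp [e])
  exact ⟨L, u, v, u' ≫ c.hom, c.inv ≫ v', hL, hL'.of_mid_iso c rfl (by simp)⟩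

end ExtriangulatedStructure

open ExtriangulatedStructure

variable {X : ExtriangulatedStructure.{w} 𝒞} {ξ : TriangleClass X}

/-! ### Composition of `ξ`-inflations -/

/-- In the situation of (ET4) the composite of two inflations of triangles in `ξ` gives a triangle
in `ξ`. Saturation is applied to the deflation `D ⊞ C ⟶ G` of the pushout square of `f'` and `g`,
along which the composite triangle becomes a base change of the first one. -/
lemma IsProperClass.comp (hξ : IsProperClass ξ) {A B C D F G : 𝒞} {f : A ⟶ B} {f' : B ⟶ D}
    {δ : Extn X.E D A} {g : B ⟶ C} {g' : C ⟶ F} {δ' : Extn X.E F B} {h' : C ⟶ G} {d : D ⟶ G}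
    {e : G ⟶ F} {δ'' : Extn X.E G A} (hf : ξ f f' δ) (hg : ξ g g' δ') (hh : h' ≫ e = g')
    (htri : X.Triangle (f ≫ g) h' δ'') (hde : X.Triangle d e (push X.E f' δ'))
    (hδ : pull X.E d δ'' = δ) : ξ (f ≫ g) h' δ'' := by
  obtain ⟨b, hb, hpo⟩ := (hξ.triangle hg).pushout f' hde
  obtain ⟨t, ht⟩ := hde.exists_lift (b - h') (by simp [Preadditive.sub_comp, hb, hh])
  have hpull : pull X.E (biprod.desc d b) δ'' = pull X.E (biprod.desc (𝟙 D) t) δ := by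
    have hb' : b = h' + t ≫ d := by rw [ht]; abel
    have h₁ : pull X.E b δ'' = pull X.E t δ := by
      rw [hb', X.pull_add, htri.pull_eq_zero, zero_add, pull_comp, hδ]
    rw [biprod.desc_eq, biprod.desc_eq, X.pull_add, X.pull_add, pull_comp, pull_comp, pull_comp,
      pull_comp, h₁, hδ, pull_id]
  obtain ⟨M, m, n, hM⟩ := X.exists_triangle (pull X.E (biprod.desc (𝟙 D) t) δ)
  refine hξ.saturated (m₁ := m) (e₁ := n) htri (hξ.base_change e hg hpo) ?_
  rw [hpull]
  exact hξ.base_change _ hf hM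

/-! ### Exactness of `Hom` functors on triangles -/

lemma homToExact_of_triangle {A B C V : 𝒞} {x : A ⟶ B} {y : B ⟶ C} {δ : Extn X.E C A}
    (h : X.Triangle x y δ) (hinj : ∀ k : C ⟶ V, y ≫ k = 0 → k = 0)
    (hsurj : ∀ k : A ⟶ V, ∃ l : B ⟶ V, x ≫ l = k) : HomToExact V x y := by
  refine ⟨fun k l hkl => ?_, fun k => ⟨fun hk => h.exists_desc k hk, ?_⟩, hsurj⟩
  · rw [← sub_eq_zero]
    exact hinj _ (by simpa [Preadditive.comp_sub, sub_eq_zero] using hkl)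
  · rintro ⟨l, rfl⟩
    simp [reassoc_of% h.comp_eq_zero]

lemma homFromExact_of_triangle {A B C V : 𝒞} {x : A ⟶ B} {y : B ⟶ C} {δ : Extn X.E C A}
    (h : X.Triangle x y δ) (hinj : ∀ k : V ⟶ A, k ≫ x = 0 → k = 0)
    (hsurj : ∀ k : V ⟶ C, ∃ l : V ⟶ B, l ≫ y = k) : HomFromExact V x y := by
  refine ⟨fun k l hkl => ?_, fun k => ⟨fun hk => h.exists_lift k hk, ?_⟩, hsurj⟩
  · rw [← sub_eq_zero]
    exact hinj _ (by simpa [Preadditive.sub_comp, sub_eq_zero] using hkl)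
  · rintro ⟨l, rfl⟩
    simp [h.comp_eq_zero]


/-- The `𝒞(-, 𝒲)`-exact `𝔼`-triangles in `ξ` that are moreover `𝒞(𝒲, -)`-exact in case the
proposition `P` holds. The parameter `P` allows a single construction to serve for coresolutions with
and without the `𝒞(𝒲, -)`-exactness. -/
def exactTriangles (ξ : TriangleClass X) (𝒲 : ObjectProperty 𝒞) (P : Prop) : TriangleClass X :=
  fun _ _ _ x y δ => toExactTriangles ξ 𝒲 x y δ ∧ (P → ∀ V, 𝒲 V → HomFromExact V x y)

variable {𝒲 : ObjectProperty 𝒞} {P : Prop}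

lemma exactTriangles.cobase_change {A B C A' B' : 𝒞} {x : A ⟶ B} {y : B ⟶ C}
    {δ : Extn X.E C A} (h : exactTriangles ξ 𝒲 P x y δ) (hξ : IsProperClass ξ) {a : A ⟶ A'}
    {x' : A' ⟶ B'} {y' : B' ⟶ C} (h' : X.Triangle x' y' (push X.E a δ)) :
    exactTriangles ξ 𝒲 P x' y' (push X.E a δ) := by
  obtain ⟨⟨hx, hto⟩, hfrom⟩ := h
  obtain ⟨b, hb, hpo⟩ := (hξ.triangle hx).pushout a h'
  have hb' : x ≫ b = a ≫ x' := by
    have := hpo.comp_eq_zero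
    rw [biprod.lift_desc, Preadditive.neg_comp, neg_add_eq_zero] at this
    exact this.symm
  refine ⟨⟨hξ.cobase_change a hx h', fun V hV => homToExact_of_triangle h' ?_ ?_⟩,
    fun hP V hV => homFromExact_of_triangle h' ?_ ?_⟩
  · exact fun k hk => (hto V hV).eq_zero (by rw [← hb, Category.assoc, hk, comp_zero])
  · intro k
    obtain ⟨l, hl⟩ := (hto V hV).2.2 (a ≫ k)
    refine h'.exists_desc_of_push k ?_
    rw [← push_comp, show a ≫ k = x ≫ l from hl.symm, push_comp,
      (hξ.triangle hx).push_eq_zero, map_zero]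
  · intro k hk
    -- the pushout triangle lifts `(k, 0)` to `A`, where it vanishes because `x` is monic against `V`
    obtain ⟨s, hs⟩ := hpo.exists_lift (biprod.lift k 0) (by simp [hk])
    have h₁ := congrArg (· ≫ biprod.fst) hs
    have h₂ := congrArg (· ≫ biprod.snd) hs
    simp only [Category.assoc, biprod.lift_fst, biprod.lift_snd] at h₁ h₂
    rw [← h₁, (hfrom hP V hV).eq_zero h₂, zero_comp]
  · intro k
    obtain ⟨l, hl⟩ := (hfrom hP V hV).2.2 k
    exact ⟨l ≫ b, by simpa [hb] using hl⟩

lemma exactTriangles.comp (hξ : IsProperClass ξ) {A B C D F G : 𝒞} {f : A ⟶ B} {f' : B ⟶ D}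
    {δ : Extn X.E D A} {g : B ⟶ C} {g' : C ⟶ F} {δ' : Extn X.E F B} {h' : C ⟶ G} {d : D ⟶ G}
    {e : G ⟶ F} {δ'' : Extn X.E G A} (hf : exactTriangles ξ 𝒲 P f f' δ)
    (hg : exactTriangles ξ 𝒲 P g g' δ') (hgd : g ≫ h' = f' ≫ d) (hh : h' ≫ e = g')
    (htri : X.Triangle (f ≫ g) h' δ'') (hde : X.Triangle d e (push X.E f' δ'))
    (hδ : pull X.E d δ'' = δ) : exactTriangles ξ 𝒲 P (f ≫ g) h' δ'' := by
  refine ⟨⟨hξ.comp hf.1.1 hg.1.1 hh htri hde hδ, fun V hV => homToExact_of_triangle htri ?_ ?_⟩,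
    fun hP V hV => homFromExact_of_triangle htri ?_ ?_⟩
  · intro k hk
    have hdk : d ≫ k = 0 := (hf.1.2 V hV).eq_zero (by rw [← reassoc_of% hgd, hk, comp_zero])
    obtain ⟨l, rfl⟩ := hde.exists_desc k hdk
    rw [(hg.1.2 V hV).eq_zero (k := l) (by rw [← hh, Category.assoc, hk]), comp_zero]
  · intro k
    obtain ⟨l, hl⟩ := (hf.1.2 V hV).2.2 k
    obtain ⟨m, hm⟩ := (hg.1.2 V hV).2.2 l
    exact ⟨m, by rw [← hl, ← hm, Category.assoc]⟩
  · intro k hk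
    exact (hf.2 hP V hV).eq_zero ((hg.2 hP V hV).eq_zero (by rw [Category.assoc, hk]))
  · intro k
    obtain ⟨l, hl⟩ := (hg.2 hP V hV).2.2 (k ≫ e)
    obtain ⟨s, hs⟩ := hde.exists_lift (k - l ≫ h') (by
      rw [Preadditive.sub_comp, Category.assoc, hh, sub_eq_zero]
      exact hl.symm)
    obtain ⟨m, hm⟩ := (hf.2 hP V hV).2.2 s
    refine ⟨l + m ≫ g, ?_⟩
    have hm' : m ≫ f' = s := hm
    rw [Preadditive.add_comp, Category.assoc, hgd, reassoc_of% hm', hs]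
    abel

/-! ### The horseshoe lemma for coresolutions -/

/-- One step of the horseshoe lemma. A morphism `L ⟶ W` extending `A ⟶ W` exhibits `A ⟶ L ⟶ B` as a
base change of `A ⟶ W ⟶ A'`, so that `L ⟶ W ⊞ B` is an inflation with cone `A'`; it is composed
with `W ⊞ B ⟶ W ⊞ W'`. -/
lemma exists_horseshoe_step (hξ : IsProperClass ξ) {A L B A' B' W W' : 𝒞} {u : A ⟶ L} {v : L ⟶ B}
    {σ : Extn X.E B A} (hL : toExactTriangles ξ 𝒲 u v σ) (hW : 𝒲 W) {a : A ⟶ W} {p : W ⟶ A'}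
    {α : Extn X.E A' A} (ha : exactTriangles ξ 𝒲 P a p α) {b : B ⟶ W'} {q : W' ⟶ B'}
    {β : Extn X.E B' B} (hb : exactTriangles ξ 𝒲 P b q β) :
    ∃ (L' : 𝒞) (u' : A' ⟶ L') (v' : L' ⟶ B') (σ' : Extn X.E B' A') (g : L ⟶ W ⊞ W')
      (f : W ⊞ W' ⟶ L') (τ : Extn X.E L' L),
      toExactTriangles ξ 𝒲 u' v' σ' ∧ exactTriangles ξ 𝒲 P g f τ := by
  obtain ⟨r, hr⟩ := (hL.2 W hW).2.2 a
  obtain ⟨c, -, hc⟩ := X.et3 (hξ.triangle hL.1) (hξ.triangle ha.1.1) (𝟙 A) r (by simpa using hr)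
  rw [push_id] at hc
  obtain ⟨s, -, hs⟩ := (hξ.triangle ha.1.1).pullback c (hc ▸ hξ.triangle hL.1)
  have h₁ := ha.cobase_change hξ hs
  have h₂ := hb.cobase_change hξ ((hξ.triangle hb.1.1).add_id_left W)
  obtain ⟨G, f, u', v', τ, e₁, e₂, e₃, e₄, e₅, -⟩ :=
    X.et4 (hξ.triangle h₁.1.1) (hξ.triangle h₂.1.1)
  exact ⟨G, u', v', _, _, f, τ, (h₂.cobase_change hξ e₄).1,
    exactTriangles.comp hξ h₁ h₂ e₁ e₂ e₃ e₄ e₅⟩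

/-- The horseshoe lemma: an `𝔼`-triangle `A ⟶ L ⟶ B` which is `𝒞(-, 𝒲)`-exact and coresolutions of
its ends give a coresolution of `L` by direct sums. -/
lemma exists_horseshoe (hξ : IsProperClass ξ) {A L B : 𝒞} {u : A ⟶ L} {v : L ⟶ B}
    {σ : Extn X.E B A} (hL : toExactTriangles ξ 𝒲 u v σ) {W W' : ℕ → 𝒞} (hW : ∀ i, 𝒲 (W i))
    {ε : A ⟶ W 0} {d : ∀ i, W i ⟶ W (i + 1)} (hA : SplicedFrom (exactTriangles ξ 𝒲 P) ε d)
    {ε' : B ⟶ W' 0} {d' : ∀ i, W' i ⟶ W' (i + 1)}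
    (hB : SplicedFrom (exactTriangles ξ 𝒲 P) ε' d') :
    ∃ (ε'' : L ⟶ W 0 ⊞ W' 0) (d'' : ∀ i, W i ⊞ W' i ⟶ W (i + 1) ⊞ W' (i + 1)),
      SplicedFrom (W := fun i => W i ⊞ W' i) (exactTriangles ξ 𝒲 P) ε'' d'' := by
  obtain ⟨K, f, g, α₀, α, hA₀, hA₁, -⟩ := hA
  obtain ⟨K', f', g', β₀, β, hB₀, hB₁, -⟩ := hB
  -- the `i`-th syzygy is constructed together with its triangle `K i ⟶ L ⟶ K' i`
  let Stage (i : ℕ) : Type _ :=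
    { L : 𝒞 // ∃ (u : K i ⟶ L) (v : L ⟶ K' i) (σ : Extn X.E (K' i) (K i)),
      toExactTriangles ξ 𝒲 u v σ }
  have init : ∃ (S : Stage 0) (g : L ⟶ W 0 ⊞ W' 0) (f : W 0 ⊞ W' 0 ⟶ S.1) (τ : Extn X.E S.1 L),
      exactTriangles ξ 𝒲 P g f τ := by
    obtain ⟨L', u', v', σ', g, f, τ, h, h'⟩ := exists_horseshoe_step hξ hL (hW 0) hA₀ hB₀
    exact ⟨⟨L', u', v', σ', h⟩, g, f, τ, h'⟩
  have step : ∀ (i : ℕ) (S : Stage i), ∃ (T : Stage (i + 1)) (g : S.1 ⟶ W (i + 1) ⊞ W' (i + 1))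
      (f : W (i + 1) ⊞ W' (i + 1) ⟶ T.1) (τ : Extn X.E T.1 S.1),
      exactTriangles ξ 𝒲 P g f τ := by
    rintro i ⟨L, u, v, σ, h⟩
    obtain ⟨L', u', v', σ', g, f, τ, h, h'⟩ :=
      exists_horseshoe_step hξ h (hW (i + 1)) (hA₁ i) (hB₁ i)
    exact ⟨⟨L', u', v', σ', h⟩, g, f, τ, h'⟩
  obtain ⟨S₀, γ, φ₀, τ₀, h₀⟩ := init
  choose next γ' φ τ h using step
  let S : ∀ i, Stage i := fun i => Nat.rec S₀ next i
  let F : ∀ i, W i ⊞ W' i ⟶ (S i).1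
    | 0 => φ₀
    | i + 1 => φ i (S i)
  exact ⟨γ, fun i => F i ≫ γ' i (S i), fun i => (S i).1, F, fun i => γ' i (S i), τ₀,
    fun i => τ i (S i), h₀, fun i => h i (S i), fun _ => rfl⟩

/-! ### The coresolution of the cone -/

/-- If `Z ⟶ L ⟶ Y` is in `ξ` and `0 ⟶ L ⟶ W 0 ⟶ W 1 ⟶ ⋯` is a coresolution, then dividing `Z` out of
`L` and of `W 0` gives a coresolution of `Y`, which differs only in degree zero. -/
lemma exists_coresolution_quotient (hξ : IsProperClass ξ) {Z L Y : 𝒞} {m : Z ⟶ L} {n : L ⟶ Y}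
    {ζ : Extn X.E Y Z} (hZ : ξ m n ζ) {W₀ W₁ : ℕ → 𝒞} {ε : L ⟶ W₀ 0 ⊞ W₁ 1}
    {d : ∀ i, W₀ i ⊞ W₁ (i + 1) ⟶ W₀ (i + 1) ⊞ W₁ (i + 2)}
    (hL : SplicedFrom (W := fun i => W₀ i ⊞ W₁ (i + 1)) (exactTriangles ξ 𝒲 P) ε d) :
    ∃ (W : 𝒞) (ε' : Y ⟶ coneTerms W W₀ W₁ 0)
      (d' : ∀ i, coneTerms W W₀ W₁ i ⟶ coneTerms W W₀ W₁ (i + 1)),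
      SplicedFrom (exactTriangles ξ 𝒲 P) ε' d' ∧
      ∃ (p : Z ⟶ W₀ 0 ⊞ W₁ 1) (q : W₀ 0 ⊞ W₁ 1 ⟶ W) (ρ : Extn X.E W Z), ξ p q ρ := by
  obtain ⟨K, f, g, δ₀, δ, h₀, h, -⟩ := hL
  obtain ⟨W, q, ε', e, ρ, -, e₂, e₃, e₄, e₅, -⟩ := X.et4 (hξ.triangle hZ) (hξ.triangle h₀.1.1)
  let F : ∀ i, coneTerms W W₀ W₁ i ⟶ K i
    | 0 => e
    | i + 1 => f (i + 1)
  exact ⟨W, ε', fun i => F i ≫ g i, ⟨K, F, g, _, δ, h₀.cobase_change hξ e₄, h,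
    fun _ => rfl⟩, _, q, ρ, hξ.comp hZ h₀.1.1 e₂ e₃ e₄ e₅⟩

/-- A `𝒞(-, 𝒲)`-exact splicing of a complex with terms in `𝒲` is unique up to isomorphism, hence
inherits `𝒞(𝒲, -)`-exactness from any other splicing. -/
lemma IsCoproperCoresolution.exactTriangles {Y : 𝒞} {W : ℕ → 𝒞} {ε : Y ⟶ W 0}
    {d : ∀ i, W i ⟶ W (i + 1)} (h : IsCoproperCoresolution ξ 𝒲 ε d) (hξ : IsProperClass ξ)
    (hP : P → SplicedFrom (fromExactTriangles ξ 𝒲) ε d) :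
    SplicedFrom (exactTriangles ξ 𝒲 P) ε d := by
  obtain ⟨hW, K, f, g, δ₀, δ, h₀, h, hd⟩ := h
  suffices hs : P → (∀ V, 𝒲 V → HomFromExact V ε (f 0)) ∧
      ∀ i V, 𝒲 V → HomFromExact V (g i) (f (i + 1)) from
    ⟨K, f, g, δ₀, δ, ⟨h₀, fun p => (hs p).1⟩, fun i => ⟨h i, fun p => (hs p).2 i⟩, hd⟩
  intro p
  obtain ⟨K', f', g', δ₀', δ', h₀', h', hd'⟩ := hP p
  have hf : ∀ i (k l : K i ⟶ W (i + 1)), f i ≫ k = f i ≫ l → k = l := by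
    rintro (_ | i) k l hkl
    · exact (h₀.2 _ (hW 1)).1 hkl
    · exact ((h i).2 _ (hW (i + 2))).1 hkl
  have hg : ∀ i (c : K i ≅ K' i), f i ≫ c.hom = f' i → g i = c.hom ≫ g' i := fun i c hc =>
    hf i _ _ (by rw [← hd, hd', reassoc_of% hc])
  have hc : ∀ i, ∃ c : K i ≅ K' i, f i ≫ c.hom = f' i := by
    intro i
    induction i with
    | zero =>
      simpa using (hξ.triangle h₀.1).exists_cone_iso (hξ.triangle h₀'.1) (Iso.refl _)
        (Iso.refl _) (by simp)
    | succ i ih =>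
      obtain ⟨c, hc⟩ := ih
      simpa using (hξ.triangle (h i).1).exists_cone_iso (hξ.triangle (h' i).1) c
        (Iso.refl _) (by simp [hg i c hc])
  choose c hc using hc
  exact ⟨fun V hV => (h₀'.2 V hV).of_iso (Iso.refl _) (Iso.refl _) (c 0) (by simp) (by simp [hc]),
    fun i V hV => ((h' i).2 V hV).of_iso (c i) (Iso.refl _) (c (i + 1))
      (by simp [hg i _ (hc i)]) (by simp [hc])⟩

lemma SplicedFrom.mono {η η' : TriangleClass X} {Y : 𝒞} {W : ℕ → 𝒞} {ε : Y ⟶ W 0}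
    {d : ∀ i, W i ⟶ W (i + 1)} (h : SplicedFrom η ε d)
    (hη : ∀ ⦃A B C : 𝒞⦄ (x : A ⟶ B) (y : B ⟶ C) (δ : Extn X.E C A), η x y δ → η' x y δ) :
    SplicedFrom η' ε d := by
  obtain ⟨K, f, g, δ₀, δ, h₀, h, hd⟩ := h
  exact ⟨K, f, g, δ₀, δ, hη _ _ _ h₀, fun i => hη _ _ _ (h i), hd⟩

end Structure

end Extri

theorem mainTheorem3 {𝒞 : Type u} [Category.{v} 𝒞] [Preadditive 𝒞] [HasZeroObject 𝒞]
    [HasBinaryBiproducts 𝒞] (X : Extri.ExtriangulatedStructure.{w} 𝒞) (hWIC : X.WIC)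
    (ξ : Extri.TriangleClass X) (hξ : Extri.IsProperClass ξ)
    (hproj : Extri.EnoughXiProjectives ξ) (hinj : Extri.EnoughXiInjectives ξ)
    (𝒲 : ObjectProperty 𝒞) (hsum : Extri.ClosedUnderDirectSums 𝒲)
    (hcok : Extri.ClosedUnderHocokernels ξ 𝒲)
    {Y₁ Y₀ Y : 𝒞} (x : Y₁ ⟶ Y₀) (y : Y₀ ⟶ Y) (δ : Extri.Extn X.E Y Y₁) (hδ : ξ x y δ)
    (W₀ W₁ : ℕ → 𝒞)
    (ε₀ : Y₀ ⟶ W₀ 0) (d₀ : ∀ i, W₀ i ⟶ W₀ (i + 1))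
    (h₀ : Extri.IsCoproperCoresolution ξ 𝒲 ε₀ d₀)
    (ε₁ : Y₁ ⟶ W₁ 0) (d₁ : ∀ i, W₁ i ⟶ W₁ (i + 1))
    (h₁ : Extri.IsCoproperCoresolution ξ 𝒲 ε₁ d₁) :
    ∃ (W : 𝒞) (ε : Y ⟶ Extri.coneTerms W W₀ W₁ 0)
      (d : ∀ i, Extri.coneTerms W W₀ W₁ i ⟶ Extri.coneTerms W W₀ W₁ (i + 1)),
      Extri.IsCoproperCoresolution ξ 𝒲 ε d ∧
      (∃ (p : W₁ 0 ⟶ W₀ 0 ⊞ W₁ 1) (q : W₀ 0 ⊞ W₁ 1 ⟶ W) (ρ : Extri.Extn X.E W (W₁ 0)),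
        ξ p q ρ) ∧
      (Extri.SplicedFrom (Extri.fromExactTriangles ξ 𝒲) ε₀ d₀ →
        Extri.SplicedFrom (Extri.fromExactTriangles ξ 𝒲) ε₁ d₁ →
        (∀ V, 𝒲 V → Extri.HomFromExact V x y) →
        Extri.SplicedFrom (Extri.fromExactTriangles ξ 𝒲) ε d) := by
  obtain ⟨W, ε, d, hY, p, q, ρ, hρ⟩ : ∃ (W : 𝒞) (ε : Y ⟶ Extri.coneTerms W W₀ W₁ 0)
      (d : ∀ i, Extri.coneTerms W W₀ W₁ i ⟶ Extri.coneTerms W W₀ W₁ (i + 1)),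
      Extri.SplicedFrom (Extri.exactTriangles ξ 𝒲
        (Extri.SplicedFrom (Extri.fromExactTriangles ξ 𝒲) ε₀ d₀ ∧
          Extri.SplicedFrom (Extri.fromExactTriangles ξ 𝒲) ε₁ d₁)) ε d ∧
      ∃ (p : W₁ 0 ⟶ W₀ 0 ⊞ W₁ 1) (q : W₀ 0 ⊞ W₁ 1 ⟶ W) (ρ : Extri.Extn X.E W (W₁ 0)),
        ξ p q ρ := by
    have hY₀ := h₀.exactTriangles hξ (And.left : Extri.SplicedFrom _ ε₀ d₀ ∧
      Extri.SplicedFrom (Extri.fromExactTriangles ξ 𝒲) ε₁ d₁ → _)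
    obtain ⟨K, f, g, α₀, α, hα₀, hα, hd₁⟩ :=
      h₁.exactTriangles hξ (And.right : Extri.SplicedFrom (Extri.fromExactTriangles ξ 𝒲) ε₀ d₀ ∧
        Extri.SplicedFrom _ ε₁ d₁ → _)
    -- `L` is the pushout of `Y₀` and `W₁ 0` over `Y₁`
    obtain ⟨L, m, n, u, v, hL, hL'⟩ :=
      (hξ.triangle hδ).exists_common_pushout (hξ.triangle hα₀.1.1)
    obtain ⟨ε', d', hd'⟩ := Extri.exists_horseshoe hξ (hα₀.cobase_change hξ hL').1 h₀.1 hY₀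
      (W' := fun i => W₁ (i + 1)) (ε' := g 0) (d' := fun i => d₁ (i + 1))
      ⟨fun i => K (i + 1), fun i => f (i + 1), fun i => g (i + 1), α 0, fun i => α (i + 1), hα 0,
        fun i => hα (i + 1), fun i => hd₁ (i + 1)⟩
    exact Extri.exists_coresolution_quotient hξ (hξ.cobase_change ε₁ hδ hL) hd'
  refine ⟨W, ε, d, ⟨?_, hY.mono fun _ _ _ _ _ _ h => h.1⟩, ⟨p, q, ρ, hρ⟩, fun hF₀ hF₁ _ =>
    hY.mono fun _ _ _ _ _ _ h => ⟨h.1.1, h.2 ⟨hF₀, hF₁⟩⟩⟩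
  rintro (_ | i)
  · exact hcok _ _ _ hρ (h₁.1 0) (hsum (h₀.1 0) (h₁.1 1))
  · exact hsum (h₀.1 (i + 1)) (h₁.1 (i + 2))
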